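/- All topological spaces are $T_0$ and are ordered by the specialization order $x\sqsubseteq y \iff x\in\overline{\{y\}}$. A directed subset $D$ (always non-empty) of a space $X$ converges to $x$, written $D\to x$, if the net $(d)_{d\in D}$ is eventually in every open neighbourhood of $x$. A subset $U\subseteq X$ is directed-open if $D\to x\in U$ implies $D\cap U\neq\emptyset$ for every directed $D\subseteq X$ and every $x\in X$; the directed-open sets form a topology, and $\mathcal D X$ denotes $X$ with this topology. A $T_0$ space $X$ is a directed space if every directed-open set is open. An element $x$ is compact if for every directed $D\subseteq X$ with $D\to x$ there is $d\in D$ with $x\sqsubseteq d$; $K(X)$ is the set of compact elements. $X$ is an algebraic space if it is a directed space and, for each $x\in X$, the set ${\downarrow}x\cap K(X)$ is directed and converges to $x$. Let $\Sigma$ be a finitary signature and $\mathcal E$ a set of pairs $(\tau_1,\tau_2)$ of $\Sigma$-terms over a fixed countably infinite set of variables. Let $\mathbf{DTop}(\Sigma,\mathcal E)$ be the category whose objects are the $\Sigma$-algebras whose carrier $A$ is a directed space, whose operations $f:\mathcal D(A^{n})\to A$ are continuous ($A^n$ with the product topology), and which satisfy $\tau_1\sqsubseteq\tau_2$ for every $(\tau_1,\tau_2)\in\mathcal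 E$ under every assignment of the variables; its morphisms are the continuous homomorphisms. A free algebra over a directed space $X$ is an object $F(X)$, with carrier space $UF(X)$, together with a continuous map $\eta:X\to UF(X)$ such that every continuous map $f$ from $X$ to the carrier of an object $B$ factors as $f=\bar f\circ\eta$ for a unique morphism $\bar f:F(X)\to B$. **Proposition.** Let $X$ be an algebraic space. Then the free algebra $F(X)$ over $X$ with respect to $\mathbf{DTop}(\Sigma,\mathcal E)$ exists, and its carrier $UF(X)$ is again an algebraic space. Moreover, $UF(X)$ is equal to the subalgebra generated by $\eta(X)$, and every element of $UF(X)$ is both a limit and the supremum of a directed set of compact elements of $UF(X)$. -/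

import Mathlib

universe u v w

/-! ### Directed spaces and algebraic spaces -/

/-- The specialization order `x ⊑ y` of a topological space. -/
def SpecLE {X : Type u} [TopologicalSpace X] (x y : X) : Prop :=
  x ∈ closure ({y} : Set X)

/-- Directed subsets with respect to the specialization order; they are non-empty. -/
def IsDirectedSubset {X : Type u} [TopologicalSpace X] (D : Set X) : Prop :=
  D.Nonempty ∧ DirectedOn SpecLE D

/-- `D → x`: the subset `D`, regarded as the net `(d)_{d ∈ D}` indexed by itself,
is eventually in every open neighbourhood of `x`. -/
def ConvergesTo {X : Type u} [TopologicalSpace X] (D : Set X) (x : X) : Prop :=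
  ∀ U : Set X, IsOpen U → x ∈ U → ∃ d ∈ D, ∀ e ∈ D, SpecLE d e → e ∈ U

/-- Directed-open subsets of a topological space. -/
def IsDirectedOpen {X : Type u} [TopologicalSpace X] (U : Set X) : Prop :=
  ∀ (D : Set X) (x : X), IsDirectedSubset D → ConvergesTo D x → x ∈ U → (D ∩ U).Nonempty

/-- A directed space: a `T₀` space in which every directed-open set is open. -/
structure IsDirectedSpace (X : Type u) [TopologicalSpace X] : Prop where
  t0 : T0Space X
  isOpen_of_isDirectedOpen : ∀ U : Set X, IsDirectedOpen U → IsOpen U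

theorem SpecLE.mem_open {X : Type u} [TopologicalSpace X] {x y : X} (h : SpecLE x y)
    {U : Set X} (hU : IsOpen U) (hx : x ∈ U) : y ∈ U := by
  obtain ⟨z, hz, rfl⟩ := mem_closure_iff.1 h U hU hx
  exact hz

theorem IsDirectedOpen.mem_of_specLE {X : Type u} [TopologicalSpace X] {U : Set X}
    (hU : IsDirectedOpen U) {x y : X} (h : SpecLE x y) (hx : x ∈ U) : y ∈ U := by
  obtain ⟨z, rfl, hz⟩ := hU {y} x
    ⟨Set.singleton_nonempty y, by
      rintro a rfl b rfl
      exact ⟨_, rfl, subset_closure rfl, subset_closure rfl⟩⟩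
    (fun V hV hxV => ⟨y, rfl, by
      rintro e rfl _
      exact h.mem_open hV hxV⟩) hx
  exact hz

/-- The space `𝒟X`: the same set, with the directed-open sets of `X` as open sets. -/
@[reducible]
def directedTopology {X : Type u} (t : TopologicalSpace X) : TopologicalSpace X where
  IsOpen U := IsDirectedOpen U
  isOpen_univ := fun _ _ hD _ _ => by simpa using hD.1
  isOpen_inter := by
    rintro U V hU hV D x hD hDx ⟨hxU, hxV⟩
    obtain ⟨a, haD, haU⟩ := hU D x hD hDx hxU
    obtain ⟨b, hbD, hbV⟩ := hV D x hD hDx hxV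
    obtain ⟨c, hcD, hac, hbc⟩ := hD.2 a haD b hbD
    exact ⟨c, hcD, hU.mem_of_specLE hac haU, hV.mem_of_specLE hbc hbV⟩
  isOpen_sUnion := by
    rintro s hs D x hD hDx ⟨U, hUs, hxU⟩
    obtain ⟨a, haD, haU⟩ := hs U hUs D x hD hDx hxU
    exact ⟨a, haD, U, hUs, haU⟩

/-- The directed product `⨂_{j} X_j = 𝒟(∏_j X_j)`. -/
@[reducible]
def directedProduct {J : Type v} {X : J → Type u} (t : ∀ j, TopologicalSpace (X j)) :
    TopologicalSpace (∀ j, X j) :=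
  directedTopology (@Pi.topologicalSpace J X t)

/-- `x ≪ y`: `x` `d`-approximates `y`. -/
def WayBelow {X : Type u} [TopologicalSpace X] (x y : X) : Prop :=
  ∀ D : Set X, IsDirectedSubset D → ConvergesTo D y → ∃ d ∈ D, SpecLE x d

/-- The set `K(X)` of (`d`-)compact elements. -/
def compactElements (X : Type u) [TopologicalSpace X] : Set X :=
  {x | WayBelow x x}

/-- An algebraic space: a directed space such that, for every `x`, the set `↓x ∩ K(X)` is
directed and converges to `x`. -/
structure IsAlgebraicSpace (X : Type u) [TopologicalSpace X] : Prop where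
  isDirectedSpace : IsDirectedSpace X
  isDirectedSubset : ∀ x : X, IsDirectedSubset ({y | SpecLE y x} ∩ compactElements X)
  convergesTo : ∀ x : X, ConvergesTo ({y | SpecLE y x} ∩ compactElements X) x

/-- `x` is the supremum of `D` in the specialization order. -/
def IsSpecSup {X : Type u} [TopologicalSpace X] (D : Set X) (x : X) : Prop :=
  (∀ d ∈ D, SpecLE d x) ∧ ∀ y : X, (∀ d ∈ D, SpecLE d y) → SpecLE x y

/-! ### Algebras over a finitary signature -/

/-- A finitary signature: operation symbols together with finite arities. -/
structure Signature where
  Op : Type v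
  arity : Op → ℕ

/-- The term algebra `T_Σ(V)`. -/
inductive SigTerm (S : Signature.{v}) (V : Type u) : Type (max u v)
  | var (x : V) : SigTerm S V
  | app (i : S.Op) (a : Fin (S.arity i) → SigTerm S V) : SigTerm S V

/-- The homomorphic extension to terms of an assignment `h` of the variables. -/
def SigTerm.eval {S : Signature.{v}} {V : Type u} {A : Type w}
    (op : ∀ i : S.Op, (Fin (S.arity i) → A) → A) (h : V → A) : SigTerm S V → A
  | .var x => h x
  | .app i a => op i fun j => (a j).eval op h

/-- The objects of `DTop(Σ, ℰ)`: directed spaces with continuous `Σ`-operations (the powers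
being directed products) in which every inequality `τ₁ ≤ τ₂` with `(τ₁, τ₂) ∈ ℰ` holds. -/
structure DTopAlgebra (S : Signature.{v}) (E : Set (SigTerm S ℕ × SigTerm S ℕ)) where
  carrier : Type w
  topology : TopologicalSpace carrier
  isDirectedSpace : IsDirectedSpace carrier
  op : ∀ i : S.Op, (Fin (S.arity i) → carrier) → carrier
  continuous_op : ∀ i : S.Op,
    @Continuous _ _ (directedProduct fun _ : Fin (S.arity i) => topology) topology (op i)
  holds : ∀ p ∈ E, ∀ h : ℕ → carrier, SpecLE (p.1.eval op h) (p.2.eval op h)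

instance DTopAlgebra.instTopologicalSpace {S : Signature.{v}}
    {E : Set (SigTerm S ℕ × SigTerm S ℕ)} (A : DTopAlgebra.{v, w} S E) :
    TopologicalSpace A.carrier :=
  A.topology

/-- The morphisms of `DTop(Σ, ℰ)`: continuous homomorphisms. -/
structure IsDTopHom {S : Signature.{v}} {E : Set (SigTerm S ℕ × SigTerm S ℕ)}
    (A B : DTopAlgebra.{v, w} S E) (g : A.carrier → B.carrier) : Prop where
  continuous : Continuous g
  map_op : ∀ (i : S.Op) (a : Fin (S.arity i) → A.carrier),
    g (A.op i a) = B.op i fun j => g (a j)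

/-- `F` with unit `η : X → F` is the free algebra over `X` with respect to `DTop(Σ, ℰ)`. -/
structure IsFreeDTopAlgebra {S : Signature.{v}} {E : Set (SigTerm S ℕ × SigTerm S ℕ)}
    (X : Type u) [TopologicalSpace X] (F : DTopAlgebra.{v, w} S E)
    (η : X → F.carrier) : Prop where
  continuous_unit : Continuous η
  existsUnique_extension : ∀ (B : DTopAlgebra.{v, w} S E) (f : X → B.carrier), Continuous f →
    ∃! g : F.carrier → B.carrier, IsDTopHom F B g ∧ g ∘ η = f

/-- The carrier of the subalgebra generated by `G`: the least subset that contains `G` and is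
closed under all operations. -/
def DTopAlgebra.generated {S : Signature.{v}} {E : Set (SigTerm S ℕ × SigTerm S ℕ)}
    (A : DTopAlgebra.{v, w} S E) (G : Set A.carrier) : Set A.carrier :=
  ⋂₀ {T | G ⊆ T ∧ ∀ (i : S.Op) (a : Fin (S.arity i) → A.carrier),
    (∀ j, a j ∈ T) → A.op i a ∈ T}

/-! ### Specialization order and convergence -/

/-! In an algebraic space everything is determined by compact elements, so the free algebra can be
built from terms over `K(X)`, preordered by the least compatible preorder forced by `⊑` on `K(X)`
and by the inequalities of `E`. A term over `X` is represented by the ideal of compact terms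
approximating it (`termIdeal`). Only these ideals are kept: directed spaces need not have all
directed limits, so the full ideal completion would be too large. Every principal ideal does occur,
which already makes the space algebraic (`isAlgebraicSpace_of_ideals`), and every element is the
value of a term, so `η(X)` generates.

For the universal property, a continuous `f : X → B` is extended by evaluating terms. The values of
the approximating compact terms lie below the value of the term (`eval_specLE_of_mem_termIdeal`) and
converge to it (`exists_mem_termIdeal_eval_mem`). Hence inclusion of ideals implies `⊑` of values,
so the extension is well defined, and the same two facts give continuity. Uniqueness of free
algebras carries the result to an arbitrary one. -/

theorem specLE_iff {X : Type u} [TopologicalSpace X] {x y : X} :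
    SpecLE x y ↔ ∀ U : Set X, IsOpen U → x ∈ U → y ∈ U := by
  refine ⟨fun h U hU hx => h.mem_open hU hx, fun h => mem_closure_iff.2 fun U hU hx => ?_⟩
  exact ⟨y, h U hU hx, rfl⟩

theorem SpecLE.refl {X : Type u} [TopologicalSpace X] (x : X) : SpecLE x x :=
  subset_closure rfl

theorem SpecLE.trans {X : Type u} [TopologicalSpace X] {x y z : X} (h : SpecLE x y)
    (h' : SpecLE y z) : SpecLE x z :=
  specLE_iff.2 fun _ hU hx => h'.mem_open hU (h.mem_open hU hx)

theorem SpecLE.antisymm {X : Type u} [TopologicalSpace X] [T0Space X] {x y : X}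
    (h : SpecLE x y) (h' : SpecLE y x) : x = y :=
  (inseparable_iff_forall_isOpen.2 fun _ hU =>
    ⟨fun hx => h.mem_open hU hx, fun hy => h'.mem_open hU hy⟩).eq

theorem SpecLE.map {X : Type u} {Y : Type v} [TopologicalSpace X] [TopologicalSpace Y]
    {f : X → Y} (hf : Continuous f) {x y : X} (h : SpecLE x y) : SpecLE (f x) (f y) :=
  specLE_iff.2 fun _ hU hx => h.mem_open (hU.preimage hf) hx

theorem specLE_pi {J : Type v} {X : J → Type u} [∀ j, TopologicalSpace (X j)]
    {x y : ∀ j, X j} (h : ∀ j, SpecLE (x j) (y j)) : SpecLE x y := by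
  unfold SpecLE at *
  rw [← specializes_iff_mem_closure, specializes_pi]
  exact fun j => specializes_iff_mem_closure.2 (h j)

/-- Open sets are upper sets, so a net indexed by its own elements is eventually in an open set as
soon as it meets it. -/
theorem convergesTo_iff {X : Type u} [TopologicalSpace X] {D : Set X} {x : X} :
    ConvergesTo D x ↔ ∀ U : Set X, IsOpen U → x ∈ U → (D ∩ U).Nonempty := by
  refine ⟨fun h U hU hx => ?_, fun h U hU hx => ?_⟩
  · obtain ⟨d, hd, hdU⟩ := h U hU hx
    exact ⟨d, hd, hdU d hd (.refl d)⟩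
  · obtain ⟨d, hd, hdU⟩ := h U hU hx
    exact ⟨d, hd, fun e _ hde => hde.mem_open hU hdU⟩

theorem ConvergesTo.of_specLE {X : Type u} [TopologicalSpace X] {D : Set X} {x y : X}
    (h : ConvergesTo D y) (hxy : SpecLE x y) : ConvergesTo D x :=
  fun U hU hx => h U hU (hxy.mem_open hU hx)

theorem ConvergesTo.specLE_of_upperBound {X : Type u} [TopologicalSpace X] {D : Set X} {x y : X}
    (h : ConvergesTo D x) (hy : ∀ d ∈ D, SpecLE d y) : SpecLE x y := by
  refine specLE_iff.2 fun U hU hx => ?_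
  obtain ⟨d, hd, hdU⟩ := convergesTo_iff.1 h U hU hx
  exact (hy d hd).mem_open hU hdU

theorem isDirectedOpen_of_isOpen {X : Type u} [TopologicalSpace X] {U : Set X} (hU : IsOpen U) :
    IsDirectedOpen U :=
  fun _ _ _ hDx hx => convergesTo_iff.1 hDx U hU hx

theorem directedTopology_le {X : Type u} (t : TopologicalSpace X) : directedTopology t ≤ t :=
  fun _ hU => @isDirectedOpen_of_isOpen X t _ hU

theorem isOpen_upperSet_of_mem_compactElements {X : Type u} [TopologicalSpace X]
    (hX : IsDirectedSpace X) {k : X} (hk : k ∈ compactElements X) : IsOpen {x | SpecLE k x} :=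
  hX.isOpen_of_isDirectedOpen _ fun D _ hD hDx hkx => by
    obtain ⟨d, hd, hkd⟩ := hk D hD (hDx.of_specLE hkx)
    exact ⟨d, hd, hkd⟩

/-- It suffices that every point be the limit of some directed set of compact elements below it. -/
theorem isAlgebraicSpace_of_exists {X : Type u} [TopologicalSpace X] (hX : IsDirectedSpace X)
    (h : ∀ x : X, ∃ D ⊆ {y | SpecLE y x} ∩ compactElements X,
      IsDirectedSubset D ∧ ConvergesTo D x) : IsAlgebraicSpace X where
  isDirectedSpace := hX
  isDirectedSubset x := by
    obtain ⟨D, hDK, hD, hDx⟩ := h x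
    refine ⟨hD.1.mono hDK, fun a ha b hb => ?_⟩
    -- `D` also converges to the points below `x`, so compactness puts `a` and `b` under members of
    -- `D`, which is directed.
    obtain ⟨d, hd, had⟩ := ha.2 D hD (hDx.of_specLE ha.1)
    obtain ⟨e, he, hbe⟩ := hb.2 D hD (hDx.of_specLE hb.1)
    obtain ⟨c, hc, hdc, hec⟩ := hD.2 d hd e he
    exact ⟨c, hDK hc, had.trans hdc, hbe.trans hec⟩
  convergesTo x := by
    obtain ⟨D, hDK, -, hDx⟩ := h x
    refine convergesTo_iff.2 fun U hU hx => ?_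
    exact (convergesTo_iff.1 hDx U hU hx).mono (Set.inter_subset_inter_left U hDK)

theorem IsAlgebraicSpace.isSpecSup {X : Type u} [TopologicalSpace X] (hX : IsAlgebraicSpace X)
    (x : X) : IsSpecSup ({y | SpecLE y x} ∩ compactElements X) x :=
  ⟨fun _ hd => hd.1, fun _ hy => (hX.convergesTo x).specLE_of_upperBound hy⟩

theorem IsAlgebraicSpace.exists_compact_mem {X : Type u} [TopologicalSpace X]
    (hX : IsAlgebraicSpace X) {x : X} {U : Set X} (hU : IsOpen U) (hx : x ∈ U) :
    ∃ k : compactElements X, SpecLE k.1 x ∧ k.1 ∈ U := by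
  obtain ⟨k, hk, hkU⟩ := convergesTo_iff.1 (hX.convergesTo x) U hU hx
  exact ⟨⟨k, hk.2⟩, hk.1, hkU⟩

/-! ### Spaces of ideals -/

/-- Ideals of a type with a relation: non-empty directed lower sets. -/
structure IsIdeal {P : Type u} (r : P → P → Prop) (I : Set P) : Prop where
  nonempty : I.Nonempty
  directedOn : DirectedOn r I
  lower : ∀ ⦃p q⦄, r p q → q ∈ I → p ∈ I

theorem IsIdeal.exists_upperBound {P : Type u} {r : P → P → Prop}
    (htrans : ∀ ⦃a b c⦄, r a b → r b c → r a c)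
    {I : Set P} (hI : IsIdeal r I) :
    ∀ {n : ℕ} (f : Fin n → P), (∀ j, f j ∈ I) → ∃ p ∈ I, ∀ j, r (f j) p
  | 0, _, _ => by
    obtain ⟨p, hp⟩ := hI.nonempty
    exact ⟨p, hp, fun j => j.elim0⟩
  | n + 1, f, hf => by
    obtain ⟨p, hp, hfp⟩ := hI.exists_upperBound htrans (fun j : Fin n => f j.succ) fun j => hf _
    obtain ⟨q, hq, h0q, hpq⟩ := hI.directedOn (f 0) (hf 0) p hp
    exact ⟨q, hq, Fin.cases h0q fun j => htrans (hfp j) hpq⟩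

/-- The topology on `C` with the sets `{c | p ∈ I c}` as a basis, where `I c` is an ideal for
every `c`. -/
@[reducible]
def idealTopology {P : Type u} {C : Type v} (r : P → P → Prop) (I : C → Set P)
    (hI : ∀ c, IsIdeal r (I c)) : TopologicalSpace C where
  IsOpen U := ∀ c ∈ U, ∃ p ∈ I c, ∀ d, p ∈ I d → d ∈ U
  isOpen_univ c _ := by
    obtain ⟨p, hp⟩ := (hI c).nonempty
    exact ⟨p, hp, fun _ _ => trivial⟩
  isOpen_inter := by
    rintro U V hU hV c ⟨hcU, hcV⟩
    obtain ⟨p, hp, hpU⟩ := hU c hcU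
    obtain ⟨q, hq, hqV⟩ := hV c hcV
    obtain ⟨s, hs, hps, hqs⟩ := (hI c).directedOn p hp q hq
    exact ⟨s, hs, fun d hd => ⟨hpU d ((hI d).lower hps hd), hqV d ((hI d).lower hqs hd)⟩⟩
  isOpen_sUnion := by
    rintro T hT c ⟨U, hUT, hcU⟩
    obtain ⟨p, hp, hpU⟩ := hT U hUT c hcU
    exact ⟨p, hp, fun d hd => ⟨U, hUT, hpU d hd⟩⟩

section IdealSpace

variable {P : Type u} {C : Type v} [TopologicalSpace C] {r : P → P → Prop} {I : C → Set P}

theorem isOpen_setOf_mem_ideal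
    (hopen : ∀ U : Set C, IsOpen U ↔ ∀ c ∈ U, ∃ p ∈ I c, ∀ d, p ∈ I d → d ∈ U) (p : P) :
    IsOpen {c | p ∈ I c} :=
  (hopen _).2 fun _ hc => ⟨p, hc, fun _ hd => hd⟩

theorem specLE_iff_ideal_subset
    (hopen : ∀ U : Set C, IsOpen U ↔ ∀ c ∈ U, ∃ p ∈ I c, ∀ d, p ∈ I d → d ∈ U) {c d : C} :
    SpecLE c d ↔ I c ⊆ I d := by
  refine ⟨fun h p hp => h.mem_open (isOpen_setOf_mem_ideal hopen p) hp, fun h => ?_⟩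
  refine specLE_iff.2 fun U hU hc => ?_
  obtain ⟨p, hp, hpU⟩ := (hopen U).1 hU c hc
  exact hpU d (h hp)

/-- A space of ideals that contains all principal ideals is algebraic. -/
theorem isAlgebraicSpace_of_ideals (hrefl : ∀ p, r p p)
    (hI : ∀ c, IsIdeal r (I c)) (hinj : Function.Injective I)
    (hprin : ∀ p, ∃ c, I c = {q | r q p})
    (hopen : ∀ U : Set C, IsOpen U ↔ ∀ c ∈ U, ∃ p ∈ I c, ∀ d, p ∈ I d → d ∈ U) :
    IsAlgebraicSpace C := by
  choose pr hpr using hprin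
  -- The basic open set of `p` is thus the upper set of the principal ideal of `p`; this makes
  -- principal ideals compact.
  have hle : ∀ {p c}, SpecLE (pr p) c ↔ p ∈ I c := fun {p c} => by
    rw [specLE_iff_ideal_subset hopen, hpr]
    exact ⟨fun h => h (hrefl p), fun h q hq => (hI c).lower hq h⟩
  have hdir : ∀ c, IsDirectedSubset (pr '' I c) := fun c => by
    refine ⟨(hI c).nonempty.image pr, ?_⟩
    rintro _ ⟨p, hp, rfl⟩ _ ⟨q, hq, rfl⟩
    obtain ⟨s, hs, hps, hqs⟩ := (hI c).directedOn p hp q hq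
    exact ⟨pr s, ⟨s, hs, rfl⟩, hle.2 (by rw [hpr]; exact hps), hle.2 (by rw [hpr]; exact hqs)⟩
  have hconv : ∀ c, ConvergesTo (pr '' I c) c := fun c => by
    refine convergesTo_iff.2 fun U hU hc => ?_
    obtain ⟨p, hp, hpU⟩ := (hopen U).1 hU c hc
    exact ⟨pr p, ⟨p, hp, rfl⟩, hpU _ (by rw [hpr]; exact hrefl p)⟩
  refine isAlgebraicSpace_of_exists ⟨⟨fun c d h => hinj ?_⟩, fun U hU => (hopen U).2 ?_⟩
    fun c => ⟨pr '' I c, ?_, hdir c, hconv c⟩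
  · exact Set.Subset.antisymm
      ((specLE_iff_ideal_subset hopen).1 h.specializes'.mem_closure)
      ((specLE_iff_ideal_subset hopen).1 h.specializes.mem_closure)
  · intro c hc
    obtain ⟨_, ⟨p, hp, rfl⟩, hpU⟩ := hU _ c (hdir c) (hconv c) hc
    exact ⟨p, hp, fun d hd => hU.mem_of_specLE (hle.2 hd) hpU⟩
  · rintro _ ⟨p, hp, rfl⟩
    refine ⟨hle.2 hp, fun D _ hDp => ?_⟩
    obtain ⟨d, hd, hpd⟩ := convergesTo_iff.1 hDp _ (isOpen_setOf_mem_ideal hopen p)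
      (show p ∈ I (pr p) by rw [hpr]; exact hrefl p)
    exact ⟨d, hd, hle.2 hpd⟩

end IdealSpace

/-! ### The free ordered algebra over the compact elements -/

theorem SigTerm.eval_eval {S : Signature.{v}} {V : Type*} {W : Type*} {A : Type*}
    (op : ∀ i : S.Op, (Fin (S.arity i) → A) → A) (h : V → SigTerm S W) (k : W → A)
    (t : SigTerm S V) :
    (t.eval SigTerm.app h).eval op k = t.eval op fun x => (h x).eval op k := by
  induction t with
  | var x => rfl
  | app i a ih => exact congrArg (op i) (funext ih)

theorem SigTerm.map_eval {S : Signature.{v}} {V : Type*} {A : Type*} {B : Type*}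
    {op : ∀ i : S.Op, (Fin (S.arity i) → A) → A} {op' : ∀ i : S.Op, (Fin (S.arity i) → B) → B}
    {g : A → B} (hg : ∀ i a, g (op i a) = op' i fun j => g (a j)) (h : V → A) (t : SigTerm S V) :
    g (t.eval op h) = t.eval op' fun x => g (h x) := by
  induction t with
  | var x => rfl
  | app i a ih => exact (hg i _).trans (congrArg (op' i) (funext ih))

/-- The least preorder on terms that extends `r` on variables, is preserved by the operations and
satisfies the inequalities of `E`. -/
inductive TermLE {S : Signature.{v}} (E : Set (SigTerm S ℕ × SigTerm S ℕ)) {K : Type u}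
    (r : K → K → Prop) : SigTerm S K → SigTerm S K → Prop
  | var {x y : K} : r x y → TermLE E r (.var x) (.var y)
  | app (i : S.Op) {a b : Fin (S.arity i) → SigTerm S K} :
      (∀ j, TermLE E r (a j) (b j)) → TermLE E r (.app i a) (.app i b)
  | ineq (p : SigTerm S ℕ × SigTerm S ℕ) (h : ℕ → SigTerm S K) : p ∈ E →
      TermLE E r (p.1.eval .app h) (p.2.eval .app h)
  | refl (t : SigTerm S K) : TermLE E r t t
  | trans ⦃s t u : SigTerm S K⦄ : TermLE E r s t → TermLE E r t u → TermLE E r s u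

theorem TermLE.eval_mono {S : Signature.{v}} {E : Set (SigTerm S ℕ × SigTerm S ℕ)} {K : Type u}
    {r : K → K → Prop} {V : Type*} {h k : V → SigTerm S K} (hk : ∀ x, TermLE E r (h x) (k x))
    (t : SigTerm S V) : TermLE E r (t.eval .app h) (t.eval .app k) := by
  induction t with
  | var x => exact hk x
  | app i a ih => exact .app i ih

section Ideals

variable {S : Signature.{v}} (E : Set (SigTerm S ℕ × SigTerm S ℕ)) {K : Type u} (r : K → K → Prop)

/-- The extension of the operations on terms to ideals of terms. -/
def idealOp (i : S.Op) (I : Fin (S.arity i) → Set (SigTerm S K)) : Set (SigTerm S K) :=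
  {p | ∃ q : Fin (S.arity i) → SigTerm S K, (∀ j, q j ∈ I j) ∧ TermLE E r p (.app i q)}

variable {E r}

theorem isIdeal_idealOp (i : S.Op) {I : Fin (S.arity i) → Set (SigTerm S K)}
    (hI : ∀ j, IsIdeal (TermLE E r) (I j)) : IsIdeal (TermLE E r) (idealOp E r i I) where
  nonempty := by
    choose q hq using fun j => (hI j).nonempty
    exact ⟨.app i q, q, hq, .refl _⟩
  directedOn := by
    rintro a ⟨q, hq, haq⟩ b ⟨s, hs, hbs⟩
    choose c hc hqc hsc using fun j => (hI j).directedOn (q j) (hq j) (s j) (hs j)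
    exact ⟨.app i c, ⟨c, hc, .refl _⟩, haq.trans (.app i hqc), hbs.trans (.app i hsc)⟩
  lower := by
    rintro p q hpq ⟨s, hs, hqs⟩
    exact ⟨s, hs, hpq.trans hqs⟩

/-- A variable may occur several times in `t`, with a different approximant at each occurrence;
directedness of the ideals merges them into one assignment. This is what transfers the inequalities
of `E` from terms to ideals. -/
theorem mem_eval_idealOp_iff {H : ℕ → Set (SigTerm S K)}
    (hH : ∀ n, IsIdeal (TermLE E r) (H n)) (t : SigTerm S ℕ) {q : SigTerm S K} :
    q ∈ t.eval (idealOp E r) H ↔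
      ∃ s : ℕ → SigTerm S K, (∀ n, s n ∈ H n) ∧ TermLE E r q (t.eval .app s) := by
  induction t generalizing q with
  | var n =>
    refine ⟨fun hq => ?_, fun ⟨s, hs, hqs⟩ => (hH n).lower hqs (hs n)⟩
    -- Arbitrary values for the variables other than `n`.
    choose s hs using fun n => (hH n).nonempty
    classical
    refine ⟨Function.update s n q, fun m => ?_, ?_⟩
    · by_cases h : m = n
      · subst h
        rw [Function.update_self]
        exact hq
      · simpa [h] using hs m
    · have : (SigTerm.var n).eval .app (Function.update s n q) = q := by simp [SigTerm.eval]
      rw [this]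
      exact .refl q
  | app i a ih =>
    constructor
    · rintro ⟨p, hp, hqp⟩
      choose s hs hps using fun j => (ih j).1 (hp j)
      -- For each variable `n`, `u n` bounds the finitely many values `s j n` chosen for the
      -- arguments.
      choose u hu hsu using fun n =>
        (hH n).exists_upperBound TermLE.trans (fun j => s j n) fun j => hs j n
      exact ⟨u, hu, hqp.trans (.app i fun j => (hps j).trans (.eval_mono (fun n => hsu n j) (a j)))⟩
    · rintro ⟨s, hs, hqs⟩
      exact ⟨_, fun j => (ih j).2 ⟨s, hs, .refl _⟩, hqs⟩

end Ideals

/-! ### The free algebra -/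

section FreeAlgebra

variable {S : Signature.{v}} (E : Set (SigTerm S ℕ × SigTerm S ℕ)) (X : Type u)
  [TopologicalSpace X]

/-- The order on terms over the compact elements of `X`. -/
abbrev CompactTermLE : SigTerm S (compactElements X) → SigTerm S (compactElements X) → Prop :=
  TermLE E fun x y => SpecLE x.1 y.1

/-- The ideal of terms over compact elements of `X` approximating a generator. -/
def generatorIdeal (x : X) : Set (SigTerm S (compactElements X)) :=
  {p | ∃ k : compactElements X, SpecLE k.1 x ∧ CompactTermLE E X p (.var k)}

/-- The ideal of terms over compact elements of `X` approximating a term over `X`. -/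
def termIdeal (t : SigTerm S X) : Set (SigTerm S (compactElements X)) :=
  t.eval (idealOp E fun x y => SpecLE x.1 y.1) (generatorIdeal E X)

/-- The carrier of the free algebra. -/
def FreeCarrier : Type (max u v) :=
  Set.range (termIdeal E X)

variable {E X}

theorem isIdeal_termIdeal (hX : IsAlgebraicSpace X) (t : SigTerm S X) :
    IsIdeal (CompactTermLE E X) (termIdeal E X t) := by
  induction t with
  | var x =>
    obtain ⟨⟨k, hk⟩, hdir⟩ := hX.isDirectedSubset x
    refine ⟨⟨.var ⟨k, hk.2⟩, ⟨k, hk.2⟩, hk.1, .refl _⟩, ?_, ?_⟩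
    · rintro a ⟨k, hk, hak⟩ b ⟨l, hl, hbl⟩
      obtain ⟨m, hm, hkm, hlm⟩ := hdir k.1 ⟨hk, k.2⟩ l.1 ⟨hl, l.2⟩
      exact ⟨.var ⟨m, hm.2⟩, ⟨⟨m, hm.2⟩, hm.1, .refl _⟩, hak.trans (.var hkm),
        hbl.trans (.var hlm)⟩
    · rintro p q hpq ⟨k, hk, hqk⟩
      exact ⟨k, hk, hpq.trans hqk⟩
  | app i a ih => exact isIdeal_idealOp i ih

/-- The witness is `p` itself, read as a term over `X`: the ideal of a compact generator is
principal, and the operations preserve principal ideals. -/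
theorem exists_termIdeal_eq_principal (p : SigTerm S (compactElements X)) :
    ∃ t, termIdeal E X t = {q | CompactTermLE E X q p} := by
  induction p with
  | var k =>
    refine ⟨.var k.1, Set.ext fun q => ⟨?_, fun hq => ⟨k, .refl _, hq⟩⟩⟩
    rintro ⟨l, hl, hql⟩
    exact hql.trans (.var hl)
  | app i a ih =>
    choose t ht using ih
    refine ⟨.app i t, Set.ext fun q => ⟨?_, fun hq => ⟨a, fun j => ?_, hq⟩⟩⟩
    · rintro ⟨s, hs, hqs⟩
      refine hqs.trans (.app i fun j => ?_)
      have : s j ∈ termIdeal E X (t j) := hs j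
      rwa [ht] at this
    · have : a j ∈ termIdeal E X (t j) := by
        rw [ht]
        exact .refl _
      exact this

theorem FreeCarrier.isIdeal (hX : IsAlgebraicSpace X) (c : FreeCarrier E X) :
    IsIdeal (CompactTermLE E X) c.1 := by
  obtain ⟨_, t, rfl⟩ := c
  exact isIdeal_termIdeal hX t

variable (E X) in
/-- The operations of the free algebra. -/
def FreeCarrier.op (i : S.Op) (c : Fin (S.arity i) → FreeCarrier E X) : FreeCarrier E X :=
  ⟨idealOp E (fun x y => SpecLE x.1 y.1) i fun j => (c j).1,
    .app i fun j => (c j).2.choose,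
    congrArg (idealOp E _ i) (funext fun j => (c j).2.choose_spec)⟩

variable (E) in
/-- The topology of the free algebra. -/
@[reducible]
def freeTopology (hX : IsAlgebraicSpace X) : TopologicalSpace (FreeCarrier E X) :=
  idealTopology (CompactTermLE E X) (fun c => c.1) (FreeCarrier.isIdeal hX)

/-- A homeomorphic copy of the space of term ideals is algebraic. -/
theorem isAlgebraicSpace_of_homeomorph_freeCarrier (hX : IsAlgebraicSpace X) {C : Type w}
    [TopologicalSpace C]
    (e : @Homeomorph C (FreeCarrier E X) _ (freeTopology E hX)) : IsAlgebraicSpace C := by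
  let _ := freeTopology E hX
  refine isAlgebraicSpace_of_ideals (r := CompactTermLE E X) (I := fun c => (e c).1) .refl
    (fun c => FreeCarrier.isIdeal hX _) (Subtype.val_injective.comp e.injective) (fun p => ?_)
    fun U => ?_
  · obtain ⟨t, ht⟩ := exists_termIdeal_eq_principal (E := E) p
    exact ⟨e.symm ⟨_, t, rfl⟩, (congrArg Subtype.val (e.apply_symm_apply _)).trans ht⟩
  · rw [← e.symm.isOpen_preimage]
    constructor
    · intro h c hc
      obtain ⟨p, hp, hpU⟩ := h (e c) (by simpa using hc)
      exact ⟨p, hp, fun d hd => by simpa using hpU (e d) hd⟩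
    · intro h c hc
      obtain ⟨p, hp, hpU⟩ := h (e.symm c) hc
      exact ⟨p, by simpa using hp, fun d hd => hpU _ (by simpa using hd)⟩

variable (E) in
/-- The free algebra over an algebraic space. -/
def freeDTopAlgebra (hX : IsAlgebraicSpace X) : DTopAlgebra.{v, max u v} S E :=
  letI := freeTopology E hX
  { carrier := FreeCarrier E X
    topology := freeTopology E hX
    isDirectedSpace :=
      (isAlgebraicSpace_of_homeomorph_freeCarrier hX (Homeomorph.refl _)).isDirectedSpace
    op := FreeCarrier.op E X
    continuous_op := fun i => by
      -- The operations are continuous even for the coarser product topology.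
      refine continuous_le_dom (directedTopology_le _) ?_
      refine continuous_def.2 fun U hU => isOpen_iff_mem_nhds.2 fun c hc => ?_
      obtain ⟨p, ⟨q, hq, hpq⟩, hpU⟩ := hU _ hc
      refine Filter.mem_of_superset (IsOpen.mem_nhds
        (isOpen_set_pi (s := fun j => {d : FreeCarrier E X | q j ∈ d.1}) Set.finite_univ
          fun j _ => isOpen_setOf_mem_ideal (fun _ => Iff.rfl) (q j)) fun j _ => hq j) ?_
      exact fun d hd => hpU _ ⟨q, fun j => hd j trivial, hpq⟩
    holds := fun p hp h => by
      refine (specLE_iff_ideal_subset fun _ => Iff.rfl).2 fun q hq => ?_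
      have hval (t : SigTerm S ℕ) : (t.eval (FreeCarrier.op E X) h).1 =
          t.eval (idealOp E fun x y => SpecLE x.1 y.1) fun n => (h n).1 :=
        SigTerm.map_eval (fun _ _ => rfl) h t
      rw [hval, mem_eval_idealOp_iff fun n => (h n).isIdeal hX] at hq ⊢
      obtain ⟨s, hs, hqs⟩ := hq
      exact ⟨s, hs, hqs.trans (.ineq p s hp)⟩ }

variable (E) in
/-- The element of the free algebra denoted by a term. -/
def freeTerm (hX : IsAlgebraicSpace X) (t : SigTerm S X) : (freeDTopAlgebra E hX).carrier :=
  ⟨termIdeal E X t, t, rfl⟩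

variable (E) in
/-- The unit of the free algebra. -/
def freeUnit (hX : IsAlgebraicSpace X) (x : X) : (freeDTopAlgebra E hX).carrier :=
  freeTerm E hX (.var x)

theorem isOpen_freeDTopAlgebra_iff (hX : IsAlgebraicSpace X)
    {U : Set (freeDTopAlgebra E hX).carrier} :
    IsOpen U ↔ ∀ c ∈ U, ∃ p ∈ c.1, ∀ d : (freeDTopAlgebra E hX).carrier, p ∈ d.1 → d ∈ U :=
  Iff.rfl

theorem freeTerm_surjective (hX : IsAlgebraicSpace X) : Function.Surjective (freeTerm E hX) := by
  rintro ⟨_, t, rfl⟩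
  exact ⟨t, rfl⟩

theorem freeTerm_eq_eval (hX : IsAlgebraicSpace X) (t : SigTerm S X) :
    freeTerm E hX t = t.eval (freeDTopAlgebra E hX).op (freeUnit E hX) := by
  induction t with
  | var x => rfl
  | app i a ih => exact congrArg ((freeDTopAlgebra E hX).op i) (funext ih)

theorem continuous_freeUnit (hX : IsAlgebraicSpace X) : Continuous (freeUnit E hX) := by
  refine continuous_def.2 fun U hU => isOpen_iff_mem_nhds.2 fun x hx => ?_
  obtain ⟨p, ⟨k, hk, hpk⟩, hpU⟩ := (isOpen_freeDTopAlgebra_iff hX).1 hU _ hx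
  exact Filter.mem_of_superset
    ((isOpen_upperSet_of_mem_compactElements hX.isDirectedSpace k.2).mem_nhds hk)
    fun y hy => hpU _ ⟨k, hy, hpk⟩

end FreeAlgebra

/-! ### The universal property -/

namespace DTopAlgebra

variable {S : Signature.{v}} {E : Set (SigTerm S ℕ × SigTerm S ℕ)} (B : DTopAlgebra.{v, w} S E)

theorem isDirectedOpen_preimage_op (i : S.Op) {U : Set B.carrier} (hU : IsOpen U) :
    IsDirectedOpen (B.op i ⁻¹' U) :=
  (@continuous_def _ _ (directedProduct fun _ => B.topology) _ _).1 (B.continuous_op i) U hU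

theorem op_mono (i : S.Op) {a b : Fin (S.arity i) → B.carrier} (h : ∀ j, SpecLE (a j) (b j)) :
    SpecLE (B.op i a) (B.op i b) :=
  specLE_iff.2 fun _ hU ha =>
    IsDirectedOpen.mem_of_specLE (B.isDirectedOpen_preimage_op i hU) (specLE_pi h) ha

theorem eval_mono_of_termLE {K : Type u} {r : K → K → Prop} {f : K → B.carrier}
    (hf : ∀ x y, r x y → SpecLE (f x) (f y)) {s t : SigTerm S K} (h : TermLE E r s t) :
    SpecLE (s.eval B.op f) (t.eval B.op f) := by
  induction h with
  | var h => exact hf _ _ h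
  | app i _ ih => exact B.op_mono i ih
  | ineq p h hp =>
    rw [SigTerm.eval_eval, SigTerm.eval_eval]
    exact B.holds p hp _
  | refl t => exact .refl _
  | trans _ _ ih ih' => exact ih.trans ih'

variable {X : Type u} [TopologicalSpace X] {f : X → B.carrier}

theorem eval_specLE_of_mem_termIdeal (hf : Continuous f) {t : SigTerm S X}
    {p : SigTerm S (compactElements X)} (hp : p ∈ termIdeal E X t) :
    SpecLE (p.eval B.op fun k => f k.1) (t.eval B.op f) := by
  have hmono : ∀ x y : compactElements X, SpecLE x.1 y.1 → SpecLE (f x.1) (f y.1) :=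
    fun _ _ h => h.map hf
  induction t generalizing p with
  | var x =>
    obtain ⟨k, hk, hpk⟩ := hp
    exact (B.eval_mono_of_termLE hmono hpk).trans (hk.map hf)
  | app i a ih =>
    obtain ⟨q, hq, hpq⟩ := hp
    exact (B.eval_mono_of_termLE hmono hpq).trans (B.op_mono i fun j => ih j (hq j))

/-- The values of the approximants converge to the value of `t`. At an operation, `B.op i` is
continuous only for the directed product, so open neighbourhoods of the arguments do not suffice: a
directed set of argument tuples converging in the product is needed. -/
theorem exists_mem_termIdeal_eval_mem (hX : IsAlgebraicSpace X) (hf : Continuous f)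
    (t : SigTerm S X) {U : Set B.carrier} (hU : IsOpen U) (ht : t.eval B.op f ∈ U) :
    ∃ p ∈ termIdeal E X t, (p.eval B.op fun k => f k.1) ∈ U := by
  have hmono : ∀ x y : compactElements X, SpecLE x.1 y.1 → SpecLE (f x.1) (f y.1) :=
    fun _ _ h => h.map hf
  induction t generalizing U with
  | var x =>
    obtain ⟨k, hk, hkU⟩ := hX.exists_compact_mem (hU.preimage hf) ht
    exact ⟨.var k, ⟨k, hk, .refl _⟩, hkU⟩
  | app i a ih =>
    let D : Set (Fin (S.arity i) → B.carrier) :=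
      {b | ∃ q : Fin (S.arity i) → SigTerm S (compactElements X),
        (∀ j, q j ∈ termIdeal E X (a j)) ∧ b = fun j => (q j).eval B.op fun k => f k.1}
    have hD : IsDirectedSubset D := by
      constructor
      · choose q hq using fun j => (isIdeal_termIdeal (E := E) hX (a j)).nonempty
        exact ⟨_, q, hq, rfl⟩
      · rintro _ ⟨q, hq, rfl⟩ _ ⟨s, hs, rfl⟩
        choose c hc hqc hsc using fun j =>
          (isIdeal_termIdeal (E := E) hX (a j)).directedOn (q j) (hq j) (s j) (hs j)
        exact ⟨_, ⟨c, hc, rfl⟩, specLE_pi fun j => B.eval_mono_of_termLE hmono (hqc j),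
          specLE_pi fun j => B.eval_mono_of_termLE hmono (hsc j)⟩
    have hconv : ConvergesTo D fun j => (a j).eval B.op f := by
      refine convergesTo_iff.2 fun V hV hmem => ?_
      -- The arity is finite, so a box neighbourhood is available and the induction hypothesis
      -- applies in each coordinate.
      obtain ⟨W, hW, hWV⟩ := isOpen_pi_iff'.1 hV _ hmem
      choose q hq hqW using fun j => ih j (hW j).1 (hW j).2
      exact ⟨_, ⟨q, hq, rfl⟩, hWV fun j _ => hqW j⟩
    have hopen : IsDirectedOpen (B.op i ⁻¹' U) := B.isDirectedOpen_preimage_op i hU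
    obtain ⟨_, ⟨q, hq, rfl⟩, hqU⟩ := hopen D _ hD hconv ht
    exact ⟨.app i q, ⟨q, hq, .refl _⟩, hqU⟩

theorem eval_specLE_of_termIdeal_subset (hX : IsAlgebraicSpace X) (hf : Continuous f)
    {s t : SigTerm S X} (h : termIdeal E X s ⊆ termIdeal E X t) :
    SpecLE (s.eval B.op f) (t.eval B.op f) := by
  refine specLE_iff.2 fun U hU hs => ?_
  obtain ⟨p, hp, hpU⟩ := B.exists_mem_termIdeal_eval_mem hX hf s hU hs
  exact (B.eval_specLE_of_mem_termIdeal hf (h hp)).mem_open hU hpU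

end DTopAlgebra

section UniversalProperty

variable {S : Signature.{v}} {E : Set (SigTerm S ℕ × SigTerm S ℕ)}

theorem isFreeDTopAlgebra_freeDTopAlgebra {X : Type u} [TopologicalSpace X]
    (hX : IsAlgebraicSpace X) :
    IsFreeDTopAlgebra X (freeDTopAlgebra E hX) (freeUnit E hX) where
  continuous_unit := continuous_freeUnit hX
  existsUnique_extension B f hf := by
    have := B.isDirectedSpace.t0
    choose term hterm using freeTerm_surjective (E := E) hX
    -- The value does not depend on the term chosen to represent an element, since `B` is T₀.
    have hg (t : SigTerm S X) : (term (freeTerm E hX t)).eval B.op f = t.eval B.op f := by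
      have h : termIdeal E X (term (freeTerm E hX t)) = termIdeal E X t :=
        congrArg Subtype.val (hterm (freeTerm E hX t))
      exact (B.eval_specLE_of_termIdeal_subset hX hf h.subset).antisymm
        (B.eval_specLE_of_termIdeal_subset hX hf h.superset)
    refine ⟨fun c => (term c).eval B.op f, ⟨⟨?_, fun i c => ?_⟩, funext fun x => hg (.var x)⟩, ?_⟩
    · refine continuous_def.2 fun U hU => (isOpen_freeDTopAlgebra_iff hX).2 fun c hc => ?_
      obtain ⟨p, hp, hpU⟩ := B.exists_mem_termIdeal_eval_mem hX hf _ hU hc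
      have hval (d : (freeDTopAlgebra E hX).carrier) : termIdeal E X (term d) = d.1 :=
        congrArg Subtype.val (hterm d)
      rw [hval] at hp
      refine ⟨p, hp, fun d hd => ?_⟩
      rw [← hval] at hd
      exact (B.eval_specLE_of_mem_termIdeal hf hd).mem_open hU hpU
    · have h : (freeDTopAlgebra E hX).op i c = freeTerm E hX (.app i fun j => term (c j)) := by
        conv_lhs => rw [show c = fun j => freeTerm E hX (term (c j)) from
          funext fun j => (hterm (c j)).symm]
        rfl
      rw [h]
      exact hg _
    · rintro g ⟨hgB, rfl⟩
      funext c
      conv_lhs => rw [← hterm c, freeTerm_eq_eval]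
      exact SigTerm.map_eval hgB.map_op _ _

theorem IsDTopHom.id (A : DTopAlgebra.{v, w} S E) : IsDTopHom A A id :=
  ⟨continuous_id, fun _ _ => rfl⟩

theorem IsDTopHom.comp {A B C : DTopAlgebra.{v, w} S E} {g : B.carrier → C.carrier}
    {f : A.carrier → B.carrier} (hg : IsDTopHom B C g) (hf : IsDTopHom A B f) :
    IsDTopHom A C (g ∘ f) :=
  ⟨hg.continuous.comp hf.continuous, fun i a => by
    simp only [Function.comp_apply, hf.map_op, hg.map_op]⟩

/-- Free algebras over the same space are isomorphic. -/
theorem IsFreeDTopAlgebra.exists_homeomorph {X : Type u} [TopologicalSpace X]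
    {F G : DTopAlgebra.{v, w} S E} {η : X → F.carrier}
    {θ : X → G.carrier} (hF : IsFreeDTopAlgebra X F η) (hG : IsFreeDTopAlgebra X G θ) :
    ∃ e : F.carrier ≃ₜ G.carrier, IsDTopHom G F e.symm ∧ e.symm ∘ θ = η := by
  obtain ⟨g, ⟨hg, hgη⟩, -⟩ := hF.existsUnique_extension G θ hG.continuous_unit
  obtain ⟨k, ⟨hk, hkθ⟩, -⟩ := hG.existsUnique_extension F η hF.continuous_unit
  have hkg : k ∘ g = _root_.id :=
    (hF.existsUnique_extension F η hF.continuous_unit).unique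
      ⟨hk.comp hg, by rw [Function.comp_assoc, hgη, hkθ]⟩ ⟨.id F, rfl⟩
  have hgk : g ∘ k = _root_.id :=
    (hG.existsUnique_extension G θ hG.continuous_unit).unique
      ⟨hg.comp hk, by rw [Function.comp_assoc, hkθ, hgη]⟩ ⟨.id G, rfl⟩
  exact ⟨⟨⟨g, k, congrFun hkg, congrFun hgk⟩, hg.continuous, hk.continuous⟩, hk, hkθ⟩

theorem DTopAlgebra.eval_mem_generated (A : DTopAlgebra.{v, w} S E) {X : Type u} {η : X → A.carrier}
    (t : SigTerm S X) : t.eval A.op η ∈ A.generated (Set.range η) := by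
  rintro T ⟨hT, hop⟩
  induction t with
  | var x => exact hT ⟨x, rfl⟩
  | app i a ih => exact hop i _ ih

end UniversalProperty

theorem mainTheorem4 (S : Signature.{v}) (E : Set (SigTerm S ℕ × SigTerm S ℕ))
    (X : Type u) [TopologicalSpace X] (hX : IsAlgebraicSpace X) :
    (∃ (F : DTopAlgebra.{v, max u v} S E) (η : X → F.carrier), IsFreeDTopAlgebra X F η) ∧
    ∀ (F : DTopAlgebra.{v, max u v} S E) (η : X → F.carrier), IsFreeDTopAlgebra X F η →
      IsAlgebraicSpace F.carrier ∧
      F.generated (Set.range η) = Set.univ ∧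
      ∀ x : F.carrier, ∃ D : Set F.carrier, D ⊆ compactElements F.carrier ∧
        IsDirectedSubset D ∧ ConvergesTo D x ∧ IsSpecSup D x := by
  refine ⟨⟨_, _, isFreeDTopAlgebra_freeDTopAlgebra hX⟩, fun F η hF => ?_⟩
  obtain ⟨e, he, hη⟩ := hF.exists_homeomorph (isFreeDTopAlgebra_freeDTopAlgebra hX)
  have hA : IsAlgebraicSpace F.carrier := isAlgebraicSpace_of_homeomorph_freeCarrier hX e
  refine ⟨hA, Set.eq_univ_of_forall fun x => ?_, fun x =>
    ⟨_, Set.inter_subset_right, hA.isDirectedSubset x, hA.convergesTo x, hA.isSpecSup x⟩⟩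
  obtain ⟨t, ht⟩ := freeTerm_surjective hX (e x)
  have hx : x = t.eval F.op η := by
    rw [← e.symm_apply_apply x, ← ht, freeTerm_eq_eval, ← hη]
    exact SigTerm.map_eval he.map_op _ _
  rw [hx]
  exact F.eval_mem_generated t
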